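/- Let $\mathcal H$ be a complex Hilbert space with inner product $\langle\cdot\mid\cdot\rangle$ (linear in the first argument), and let $A$ be a bounded positive semidefinite operator on $\mathcal H$. Write $\langle x\mid y\rangle_A=\langle Ax\mid y\rangle$ and $\|x\|_A=\langle x\mid x\rangle_A^{1/2}$. For a bounded operator $T$ on $\mathcal H$ put $$\|T\|_A=\sup\{\|Tx\|_A : x\in\mathcal H,\ \|x\|_A=1\},\qquad \omega_A(T)=\sup\{|\langle Tx\mid x\rangle_A| : x\in\mathcal H,\ \|x\|_A=1\},$$ with values in $[0,\infty]$ (and $\sup\emptyset=0$). Let $\mathcal B_A(\mathcal H)$ be the set of bounded operators $T$ that admit an $A$-adjoint, i.e. for which there is a bounded operator $X$ with $\langle Tx\mid y\rangle_A=\langle x\mid Xy\rangle_A$ for all $x,y\in\mathcal H$. For $T\in\mathcal B_A(\mathcal H)$ let $T^{\sharp_A}$ be its distinguished $A$-adjoint, i.e. the unique bounded operator $X$ with $AX=T^*A$ whose range is contained in the closure of the range of $A$. Let $\mathbb A=\begin{pmatrix}A&0\\0&A\end{pmatrix}$ on the Hilbert space $\mathcal H\oplus\mathcal H$, and define $\omega_{\mathbb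 A}$ in the same way with $\mathbb A$ and $\mathcal H\oplus\mathcal H$ in place of $A$ and $\mathcal H$. Then for all $P,Q,R,S\in\mathcal B_A(\mathcal H)$, $$\omega_{\mathbb A}\!\left[\begin{pmatrix}P&Q\\R&S\end{pmatrix}\right]\le\frac12\big(\omega_A(P)+\omega_A(S)\big)+\frac14\Big(\|I+PP^{\sharp_A}+QQ^{\sharp_A}\|_A+\|I+RR^{\sharp_A}+SS^{\sharp_A}\|_A\Big),$$ and all four quantities $\omega_A(P)$, $\omega_A(S)$, $\|I+PP^{\sharp_A}+QQ^{\sharp_A}\|_A$, $\|I+RR^{\sharp_A}+SS^{\sharp_A}\|_A$ on the right-hand side are finite. -/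

import Mathlib

open scoped ENNReal

namespace SemiHilbert

section Basic

variable {E : Type*} [NormedAddCommGroup E] [InnerProductSpace ℂ E]

/-- The semi-inner product `⟨x | y⟩_A = ⟨A x | y⟩`, linear in `x` and conjugate-linear in `y`.
(Mathlib's `inner ℂ` is conjugate-linear in its first argument, hence the order.) -/
noncomputable def aInner (A : E →L[ℂ] E) (x y : E) : ℂ := inner ℂ y (A x)

/-- The seminorm `‖x‖_A = ⟨x | x⟩_A ^ (1/2)`. -/
noncomputable def aNorm (A : E →L[ℂ] E) (x : E) : ℝ := Real.sqrt (aInner A x x).re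

/-- The `A`-operator seminorm `‖T‖_A = sup {‖T x‖_A : ‖x‖_A = 1}`, with values in `[0, ∞]`. -/
noncomputable def aOpNorm (A T : E →L[ℂ] E) : ℝ≥0∞ :=
  ⨆ (x : E) (_ : aNorm A x = 1), ENNReal.ofReal (aNorm A (T x))

/-- The `A`-numerical radius `ω_A(T) = sup {|⟨T x | x⟩_A| : ‖x‖_A = 1}`,
with values in `[0, ∞]`. -/
noncomputable def aNumRadius (A T : E →L[ℂ] E) : ℝ≥0∞ :=
  ⨆ (x : E) (_ : aNorm A x = 1), ENNReal.ofReal ‖aInner A (T x) x‖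

/-- `S` is an `A`-adjoint of `T`: `⟨T x | y⟩_A = ⟨x | S y⟩_A` for all `x, y`. -/
def IsAAdjoint (A T S : E →L[ℂ] E) : Prop :=
  ∀ x y : E, aInner A (T x) y = aInner A x (S y)

/-- `T` belongs to `B_A(E)`: it admits a (bounded) `A`-adjoint. -/
def AdmitsAAdjoint (A T : E →L[ℂ] E) : Prop :=
  ∃ S : E →L[ℂ] E, IsAAdjoint A T S

end Basic

section Sharp

variable {E : Type*} [NormedAddCommGroup E] [InnerProductSpace ℂ E] [CompleteSpace E]

/-- `X` is the reduced (Douglas) solution of `A X = T* A`: it solves the equation and its range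
is contained in the closure of the range of `A`. -/
def IsReducedSolution (A T X : E →L[ℂ] E) : Prop :=
  A ∘L X = ContinuousLinearMap.adjoint T ∘L A ∧
    ∀ x : E, X x ∈ closure (Set.range A)

open Classical in
/-- The distinguished `A`-adjoint `T^{♯_A}`: the reduced solution of `A X = T* A`. It exists and
is unique whenever `T` admits an `A`-adjoint (`existsUnique_isReducedSolution`); the value is `0`
if there is none. -/
noncomputable def aSharp (A T : E →L[ℂ] E) : E →L[ℂ] E :=
  if h : ∃ X : E →L[ℂ] E, IsReducedSolution A T X then h.choose else 0

theorem isAAdjoint_iff {A : E →L[ℂ] E} (hA : A.IsPositive) (T S : E →L[ℂ] E) :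
    IsAAdjoint A T S ↔ A ∘L S = ContinuousLinearMap.adjoint T ∘L A := by
  have hs : ∀ x y : E, inner ℂ (A x) y = inner ℂ x (A y) := fun x y => hA.isSymmetric x y
  constructor
  · intro h
    ext y
    refine ext_inner_right ℂ fun x => ?_
    have := h x y
    simp only [aInner] at this
    simp only [ContinuousLinearMap.comp_apply, ContinuousLinearMap.adjoint_inner_left]
    rw [hs (S y) x, hs y (T x), this]
  · intro h x y
    have h1 : A (S y) = ContinuousLinearMap.adjoint T (A y) := by
      simpa using congrArg (fun L : E →L[ℂ] E => L y) h
    simp only [aInner]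
    rw [← hs y (T x), ← hs (S y) x, h1, ContinuousLinearMap.adjoint_inner_left]

theorem existsUnique_isReducedSolution {A T : E →L[ℂ] E} (hA : A.IsPositive)
    (hT : AdmitsAAdjoint A T) : ∃! X : E →L[ℂ] E, IsReducedSolution A T X := by
  have hs : ∀ x y : E, inner ℂ (A x) y = inner ℂ x (A y) := fun x y => hA.isSymmetric x y
  obtain ⟨S, hS⟩ := hT
  rw [isAAdjoint_iff hA] at hS
  set K : Submodule ℂ E := A.range.topologicalClosure with hK
  have hmem : ∀ x : E, x ∈ K ↔ x ∈ closure (Set.range A) := by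
    intro x
    rw [hK, ← SetLike.mem_coe, Submodule.topologicalClosure_coe]
    exact Iff.rfl
  have hc : IsClosed (K : Set E) := Submodule.isClosed_topologicalClosure _
  have : CompleteSpace K := hc.completeSpace_coe
  have hperp : ∀ z : E, z ∈ Kᗮ → A z = 0 := by
    intro z hz
    refine ext_inner_left ℂ fun x => ?_
    rw [inner_zero_right, ← hs]
    exact hz (A x) ((hmem _).2 (subset_closure ⟨x, rfl⟩))
  have hker : ∀ z : E, A z = 0 → z ∈ Kᗮ := by
    intro z hz
    rw [hK, Submodule.orthogonal_closure, Submodule.mem_orthogonal]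
    rintro _ ⟨x, rfl⟩
    have : inner ℂ (A x) z = (0 : ℂ) := by rw [hs, hz, inner_zero_right]
    simpa using this
  refine ⟨K.starProjection ∘L S, ⟨?_, ?_⟩, ?_⟩
  · rw [← hS]
    ext y
    have := hperp _ (K.sub_starProjection_mem_orthogonal (S y))
    rw [map_sub, sub_eq_zero] at this
    simpa using this.symm
  · intro x
    rw [← hmem]
    exact K.starProjection_apply_mem (S x)
  · rintro X ⟨hX1, hX2⟩
    ext y
    have h1 : A (X y - K.starProjection (S y)) = 0 := by
      have e1 : A (X y) = A (S y) := by
        have := hX1.trans hS.symm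
        simpa using congrArg (fun L : E →L[ℂ] E => L y) this
      have e2 := hperp _ (K.sub_starProjection_mem_orthogonal (S y))
      rw [map_sub] at e2 ⊢
      rw [e1, e2]
    have h2 : X y - K.starProjection (S y) ∈ K :=
      K.sub_mem ((hmem _).2 (hX2 y)) (K.starProjection_apply_mem (S y))
    have h3 := Submodule.inner_right_of_mem_orthogonal h2 (hker _ h1)
    rw [inner_self_eq_zero, sub_eq_zero] at h3
    simpa using h3

theorem aSharp_spec {A T : E →L[ℂ] E} (hA : A.IsPositive) (hT : AdmitsAAdjoint A T) :
    IsReducedSolution A T (aSharp A T) := by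
  have h := (existsUnique_isReducedSolution hA hT).exists
  rw [aSharp, dif_pos h]
  exact h.choose_spec

end Sharp

section Block

variable {E : Type*} [NormedAddCommGroup E] [InnerProductSpace ℂ E]

/-- The `2 × 2` operator matrix with rows `(P, Q)` and `(R, S)`, acting on the Hilbert space
direct sum `E ⊕ E`, that is, `WithLp 2 (E × E)`. -/
noncomputable def blockOp (P Q R S : E →L[ℂ] E) :
    WithLp 2 (E × E) →L[ℂ] WithLp 2 (E × E) :=
  ((WithLp.prodContinuousLinearEquiv 2 ℂ E E).symm : E × E →L[ℂ] WithLp 2 (E × E)) ∘L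
    ((P.coprod Q).prod (R.coprod S)) ∘L
      ((WithLp.prodContinuousLinearEquiv 2 ℂ E E) : WithLp 2 (E × E) →L[ℂ] E × E)

theorem blockOp_apply (P Q R S : E →L[ℂ] E) (x : WithLp 2 (E × E)) :
    blockOp P Q R S x = WithLp.toLp 2 (P x.fst + Q x.snd, R x.fst + S x.snd) := rfl

/-- The diagonal operator matrix `𝔸 = diag(A, A)` on `E ⊕ E`. -/
noncomputable def diagOp (A : E →L[ℂ] E) : WithLp 2 (E × E) →L[ℂ] WithLp 2 (E × E) :=
  blockOp A 0 0 A

end Block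

end SemiHilbert

open SemiHilbert

namespace SemiHilbert

/-! Factor `A = B* B`, so that `⟨x | y⟩_A` is the ordinary inner product of `B x` and `B y`. For a
unit vector `(x, z)` of `E ⊕ E` the numerical value is a sum of one term per row. In the first row
write `x = k y` with `‖y‖_A = 1` and put, in the semi-inner product, `e = (k y, z)`, `a = (y, 0)`,
`b = (P♯ y, Q♯ y)`. Up to conjugation the row term is `⟨a | e⟩ ⟨b | e⟩`, which Buzano's inequality
bounds by `(‖b‖ + |⟨P y | y⟩_A|) / 2`. Finally `2‖b‖ ≤ 1 + ‖b‖²`, and `1 + ‖b‖² = ⟨(I + P P♯ + Q Q♯)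
y | y⟩_A`.

Finiteness rests on `IsAAdjoint.aNorm_apply_le`: an `A`-selfadjoint operator is `A`-bounded, by
iterated Cauchy–Schwarz on its powers. -/

/-- Buzano's inequality. -/
theorem norm_inner_mul_inner_le {F : Type*} [NormedAddCommGroup F] [InnerProductSpace ℂ F]
    {e : F} (he : ‖e‖ = 1) (a b : F) :
    ‖inner ℂ a e * inner ℂ b e‖ ≤ (‖a‖ * ‖b‖ + ‖inner ℂ b a‖) / 2 := by
  -- This vector is the reflection of `a` in the line spanned by `e`, hence of the same norm.
  have hr : ‖(2 * inner ℂ e a) • e - a‖ = ‖a‖ := by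
    have h : (inner ℂ ((2 * inner ℂ e a) • e - a) ((2 * inner ℂ e a) • e - a) : ℂ) =
        inner ℂ a a := by
      have hee : (inner ℂ e e : ℂ) = 1 := by rw [inner_self_eq_norm_sq_to_K, he]; simp
      simp only [inner_sub_left, inner_sub_right, inner_smul_left, inner_smul_right, hee,
        map_mul, inner_conj_symm, map_ofNat]
      ring
    have h2 : ‖(2 * inner ℂ e a) • e - a‖ ^ 2 = ‖a‖ ^ 2 := by
      rw [inner_self_eq_norm_sq_to_K, inner_self_eq_norm_sq_to_K] at h
      exact_mod_cast h
    exact (sq_eq_sq₀ (norm_nonneg _) (norm_nonneg _)).1 h2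
  have h1 : 2 * (inner ℂ e a * inner ℂ b e) =
      inner ℂ b ((2 * inner ℂ e a) • e - a) + inner ℂ b a := by
    rw [inner_sub_right, inner_smul_right]; ring
  have h2 := norm_add_le (inner ℂ b ((2 * inner ℂ e a) • e - a)) (inner ℂ b a : ℂ)
  rw [← h1, norm_mul, Complex.norm_ofNat] at h2
  have h3 := norm_inner_le_norm (𝕜 := ℂ) b ((2 * inner ℂ e a) • e - a)
  rw [hr] at h3
  rw [norm_mul, norm_inner_symm a e, ← norm_mul]
  linarith

section

variable {E : Type*} [NormedAddCommGroup E] [InnerProductSpace ℂ E]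

theorem aNorm_eq {A B : E →L[ℂ] E} (hB : ∀ x y : E, aInner A x y = inner ℂ (B y) (B x)) (x : E) :
    aNorm A x = ‖B x‖ := by
  rw [aNorm, hB, inner_self_eq_norm_sq_to_K]
  norm_cast
  exact Real.sqrt_sq (norm_nonneg _)

theorem IsAAdjoint.comp {A T S T' S' : E →L[ℂ] E} (h : IsAAdjoint A T S)
    (h' : IsAAdjoint A T' S') : IsAAdjoint A (T ∘L T') (S' ∘L S) := fun x y => by
  rw [ContinuousLinearMap.comp_apply, h, h', ContinuousLinearMap.comp_apply]

theorem IsAAdjoint.add {A T S T' S' : E →L[ℂ] E} (h : IsAAdjoint A T S)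
    (h' : IsAAdjoint A T' S') : IsAAdjoint A (T + T') (S + S') := fun x y => by
  have h1 := h x y
  have h2 := h' x y
  simp only [aInner] at h1 h2 ⊢
  simp only [add_apply, map_add, inner_add_left, inner_add_right, h1, h2]

theorem isAAdjoint_id (A : E →L[ℂ] E) :
    IsAAdjoint A (ContinuousLinearMap.id ℂ E) (ContinuousLinearMap.id ℂ E) := fun _ _ => rfl

theorem norm_aInner_le_aNumRadius {A T : E →L[ℂ] E} {x : E} (hx : aNorm A x = 1)
    (hT : aNumRadius A T < ⊤) : ‖aInner A (T x) x‖ ≤ (aNumRadius A T).toReal :=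
  (ENNReal.ofReal_le_iff_le_toReal hT.ne).1
    (le_iSup₂ (f := fun (x : E) (_ : aNorm A x = 1) => ENNReal.ofReal ‖aInner A (T x) x‖) x hx)

theorem aNorm_apply_le_aOpNorm {A T : E →L[ℂ] E} {x : E} (hx : aNorm A x = 1)
    (hT : aOpNorm A T < ⊤) : aNorm A (T x) ≤ (aOpNorm A T).toReal :=
  (ENNReal.ofReal_le_iff_le_toReal hT.ne).1
    (le_iSup₂ (f := fun (x : E) (_ : aNorm A x = 1) => ENNReal.ofReal (aNorm A (T x))) x hx)

theorem aInner_diagOp (A : E →L[ℂ] E) (x y : WithLp 2 (E × E)) :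
    aInner (diagOp A) x y = aInner A x.fst y.fst + aInner A x.snd y.snd := by
  simp [aInner, diagOp, blockOp_apply, WithLp.prod_inner_apply]

variable [CompleteSpace E]

theorem exists_aInner_eq {A : E →L[ℂ] E} (hA : A.IsPositive) :
    ∃ B : E →L[ℂ] E, ∀ x y : E, aInner A x y = inner ℂ (B y) (B x) := by
  obtain ⟨B, hB⟩ := CStarAlgebra.nonneg_iff_eq_star_mul_self.1
    ((ContinuousLinearMap.nonneg_iff_isPositive A).2 hA)
  refine ⟨B, fun x y => ?_⟩
  rw [aInner, hB, ContinuousLinearMap.star_eq_adjoint, mul_apply_eq_comp,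
    ContinuousLinearMap.adjoint_inner_right]

theorem IsAAdjoint.symm {A T S : E →L[ℂ] E} (hA : A.IsPositive) (h : IsAAdjoint A T S) :
    IsAAdjoint A S T := by
  obtain ⟨B, hB⟩ := exists_aInner_eq hA
  intro x y
  have := h y x
  rw [hB, hB] at this ⊢
  rw [← inner_conj_symm, ← this, inner_conj_symm]

theorem isAAdjoint_aSharp {A T : E →L[ℂ] E} (hA : A.IsPositive) (hT : AdmitsAAdjoint A T) :
    IsAAdjoint A T (aSharp A T) :=
  (isAAdjoint_iff hA T _).2 (aSharp_spec hA hT).1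

/-- An `A`-selfadjoint operator is bounded for the `A`-seminorm, by its operator norm. -/
theorem IsAAdjoint.aNorm_apply_le {A W : E →L[ℂ] E} (hA : A.IsPositive) (hW : IsAAdjoint A W W)
    {x : E} (hx : aNorm A x = 1) : aNorm A (W x) ≤ ‖W‖ := by
  obtain ⟨B, hB⟩ := exists_aInner_eq hA
  rw [aNorm_eq hB] at hx ⊢
  have hpow : ∀ n : ℕ, IsAAdjoint A (W ^ n) (W ^ n) := by
    intro n
    induction n with
    | zero => exact isAAdjoint_id A
    | succ n ih =>
      have := hW.comp ih
      rwa [← ContinuousLinearMap.mul_def, ← ContinuousLinearMap.mul_def, ← pow_succ,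
        ← pow_succ'] at this
  -- Selfadjointness gives `‖Wⁿ x‖_A² = ⟨W²ⁿ x | x⟩_A`; then Cauchy–Schwarz.
  have hdouble : ∀ n : ℕ, ‖B ((W ^ n) x)‖ ^ 2 ≤ ‖B ((W ^ (2 * n)) x)‖ := by
    intro n
    have h := hpow n x ((W ^ n) x)
    rw [hB, hB, inner_self_eq_norm_sq_to_K,
      show (W ^ n) ((W ^ n) x) = (W ^ (2 * n)) x by rw [two_mul, pow_add]; rfl] at h
    have h1 := norm_inner_le_norm (𝕜 := ℂ) (B ((W ^ (2 * n)) x)) (B x)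
    rw [← h, hx, mul_one] at h1
    simpa using h1
  have hiter : ∀ n : ℕ, ‖B (W x)‖ ^ 2 ^ n ≤ ‖B ((W ^ 2 ^ n) x)‖ := by
    intro n
    induction n with
    | zero => simp
    | succ n ih =>
      rw [pow_succ, pow_mul, mul_comm (2 ^ n) 2]
      exact (pow_le_pow_left₀ (by positivity) ih 2).trans (hdouble _)
  have hbound : ∀ n : ℕ, ‖B (W x)‖ ^ 2 ^ n ≤ ‖W‖ ^ 2 ^ n * (‖B‖ * ‖x‖) := by
    intro n
    calc _ ≤ ‖B ((W ^ 2 ^ n) x)‖ := hiter n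
      _ ≤ ‖B‖ * ‖(W ^ 2 ^ n) x‖ := B.le_opNorm _
      _ ≤ ‖B‖ * (‖W‖ ^ 2 ^ n * ‖x‖) := by
        gcongr
        exact ((W ^ 2 ^ n).le_opNorm x).trans
          (by gcongr; exact norm_pow_le' W (by positivity))
      _ = _ := by ring
  -- Otherwise the powers `(‖W x‖_A / ‖W‖) ^ 2 ^ n` would be unbounded, against `hbound`. The case
  -- `‖W‖ = 0` is separate because of the division.
  by_contra! hlt
  rcases (norm_nonneg W).eq_or_lt with h0 | h0
  · have h1 := hbound 0
    rw [← h0] at h1 hlt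
    simp at h1 hlt
    exact hlt h1
  · have h1 : 1 < ‖B (W x)‖ / ‖W‖ := (one_lt_div h0).2 hlt
    obtain ⟨n, hn⟩ := pow_unbounded_of_one_lt (‖B‖ * ‖x‖) h1
    have h2 : (‖B (W x)‖ / ‖W‖) ^ n ≤ (‖B (W x)‖ / ‖W‖) ^ 2 ^ n :=
      pow_le_pow_right₀ h1.le Nat.lt_two_pow_self.le
    have h3 : (‖B (W x)‖ / ‖W‖) ^ 2 ^ n ≤ ‖B‖ * ‖x‖ := by
      rw [div_pow, div_le_iff₀ (by positivity), mul_comm]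
      exact hbound n
    linarith

theorem IsAAdjoint.aOpNorm_lt_top {A W : E →L[ℂ] E} (hA : A.IsPositive)
    (hW : IsAAdjoint A W W) : aOpNorm A W < ⊤ :=
  lt_of_le_of_lt
    (iSup₂_le fun _ hx => ENNReal.ofReal_le_ofReal (hW.aNorm_apply_le hA hx))
    ENNReal.ofReal_lt_top

/-- `T` need not be `A`-selfadjoint, but `S T` is, and `‖T x‖_A² = ⟨S T x | x⟩_A ≤ ‖S T‖` when
`‖x‖_A = 1`. -/
theorem AdmitsAAdjoint.aNumRadius_lt_top {A T : E →L[ℂ] E} (hA : A.IsPositive)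
    (hT : AdmitsAAdjoint A T) : aNumRadius A T < ⊤ := by
  obtain ⟨S, hS⟩ := hT
  obtain ⟨B, hB⟩ := exists_aInner_eq hA
  refine (iSup₂_le (a := ENNReal.ofReal √‖S ∘L T‖) fun x hx =>
    ENNReal.ofReal_le_ofReal ?_).trans_lt ENNReal.ofReal_lt_top
  have h1 := ((hS.symm hA).comp hS).aNorm_apply_le hA hx
  rw [aNorm_eq hB] at h1 hx
  have h2 := hS x (T x)
  rw [hB, hB, inner_self_eq_norm_sq_to_K] at h2
  have h3 := norm_inner_le_norm (𝕜 := ℂ) (B (S (T x))) (B x)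
  rw [← h2, hx, mul_one] at h3
  have h4 : ‖B (T x)‖ ^ 2 ≤ ‖S ∘L T‖ := by
    refine le_trans ?_ (h3.trans h1)
    simp
  have h5 := norm_inner_le_norm (𝕜 := ℂ) (B x) (B (T x))
  rw [hx, one_mul] at h5
  rw [hB]
  exact h5.trans (Real.le_sqrt_of_sq_le h4)

theorem norm_aInner_row_le_of_unit {A P Q P' Q' : E →L[ℂ] E} (hA : A.IsPositive)
    (hP : IsAAdjoint A P P') (hQ : IsAAdjoint A Q Q') {y z : E} {k : ℝ}
    (hy : aNorm A y = 1) (hkz : k ^ 2 + aNorm A z ^ 2 = 1) :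
    ‖aInner A (P ((k : ℂ) • y) + Q z) ((k : ℂ) • y)‖ ≤
      ‖aInner A (P y) y‖ / 2 + aNorm A (y + P (P' y) + Q (Q' y)) / 4 := by
  obtain ⟨B, hB⟩ := exists_aInner_eq hA
  rw [aNorm_eq hB] at hy hkz ⊢
  have hyy : (inner ℂ (B y) (B y) : ℂ) = 1 := by rw [inner_self_eq_norm_sq_to_K, hy]; simp
  set e : WithLp 2 (E × E) := WithLp.toLp 2 ((k : ℂ) • B y, B z) with he
  set a : WithLp 2 (E × E) := WithLp.toLp 2 (B y, 0) with ha
  set b : WithLp 2 (E × E) := WithLp.toLp 2 (B (P' y), B (Q' y)) with hb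
  have hen : ‖e‖ = 1 := by
    rw [← sq_eq_sq₀ (norm_nonneg _) zero_le_one, WithLp.prod_norm_sq_eq_of_L2]
    simpa [he, norm_smul, hy] using hkz
  have han : ‖a‖ = 1 := by
    rw [← sq_eq_sq₀ (norm_nonneg _) zero_le_one, WithLp.prod_norm_sq_eq_of_L2]
    simp [ha, hy]
  have hbn : ‖b‖ ^ 2 = ‖B (P' y)‖ ^ 2 + ‖B (Q' y)‖ ^ 2 := by
    simp [WithLp.prod_norm_sq_eq_of_L2, hb]
  have hP1 : ∀ u v, (inner ℂ (B (P' v)) (B u) : ℂ) = inner ℂ (B v) (B (P u)) := fun u v => by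
    rw [← hB, ← hB]; exact (hP u v).symm
  have hQ1 : ∀ u v, (inner ℂ (B (Q' v)) (B u) : ℂ) = inner ℂ (B v) (B (Q u)) := fun u v => by
    rw [← hB, ← hB]; exact (hQ u v).symm
  have hae : (inner ℂ a e : ℂ) = k := by
    simp [WithLp.prod_inner_apply, ha, he, inner_smul_right, hy, -Complex.coe_smul]
  have hbe : (inner ℂ b e : ℂ) = inner ℂ (B y) (B (P ((k : ℂ) • y) + Q z)) := by
    simp [WithLp.prod_inner_apply, hb, he, inner_smul_right, hP1, hQ1, -Complex.coe_smul]
  have hba : (inner ℂ b a : ℂ) = inner ℂ (B y) (B (P y)) := by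
    simp [WithLp.prod_inner_apply, hb, ha, hP1]
  have hbuz := norm_inner_mul_inner_le hen a b
  rw [hae, hbe, hba, han, one_mul] at hbuz
  have hval : aInner A (P ((k : ℂ) • y) + Q z) ((k : ℂ) • y) =
      k * inner ℂ (B y) (B (P ((k : ℂ) • y) + Q z)) := by
    rw [hB, map_smul B, inner_smul_left, Complex.conj_ofReal]
  have hm : 1 + ‖b‖ ^ 2 ≤ ‖B (y + P (P' y) + Q (Q' y))‖ := by
    have h := norm_inner_le_norm (𝕜 := ℂ) (B y) (B (y + P (P' y) + Q (Q' y)))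
    rw [hy, one_mul, map_add, map_add, inner_add_right, inner_add_right, hyy, ← hP1, ← hQ1,
      inner_self_eq_norm_sq_to_K, inner_self_eq_norm_sq_to_K] at h
    have h' := (Complex.re_le_norm _).trans h
    rw [hbn]
    rw [map_add, map_add]
    norm_cast at h'
    rw [← add_assoc]
    exact_mod_cast h'
  rw [hval, hB]
  -- The square supplies `‖b‖ / 2 ≤ (1 + ‖b‖²) / 4`, the source of the constant `1/4`.
  nlinarith [sq_nonneg (‖b‖ - 1)]

theorem isAAdjoint_id_add_comp_add_comp {A P Q P' Q' : E →L[ℂ] E} (hA : A.IsPositive)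
    (hP : IsAAdjoint A P P') (hQ : IsAAdjoint A Q Q') :
    IsAAdjoint A (ContinuousLinearMap.id ℂ E + P ∘L P' + Q ∘L Q')
      (ContinuousLinearMap.id ℂ E + P ∘L P' + Q ∘L Q') :=
  ((isAAdjoint_id A).add (hP.comp (hP.symm hA))).add (hQ.comp (hQ.symm hA))

/-- The contribution of one row of an operator matrix to its numerical values. -/
theorem norm_aInner_row_le {A P Q P' Q' : E →L[ℂ] E} (hA : A.IsPositive)
    (hP : IsAAdjoint A P P') (hQ : IsAAdjoint A Q Q') {x z : E}
    (hxz : aNorm A x ^ 2 + aNorm A z ^ 2 = 1) :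
    ‖aInner A (P x + Q z) x‖ ≤ (aNumRadius A P).toReal / 2 +
      (aOpNorm A (ContinuousLinearMap.id ℂ E + P ∘L P' + Q ∘L Q')).toReal / 4 := by
  obtain ⟨B, hB⟩ := exists_aInner_eq hA
  rcases eq_or_ne (aNorm A x) 0 with h0 | h0
  -- Here `x` cannot be normalised, but `B x = 0` makes the row term vanish.
  · rw [aNorm_eq hB, norm_eq_zero] at h0
    rw [hB, h0, inner_zero_left, norm_zero]
    positivity
  · set y : E := ((aNorm A x : ℂ)⁻¹) • x with hy
    have hxy : x = (aNorm A x : ℂ) • y := by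
      rw [hy, smul_inv_smul₀]
      exact_mod_cast h0
    have hyn : aNorm A y = 1 := by
      rw [hy, aNorm_eq hB, map_smul, norm_smul, ← aNorm_eq hB x, norm_inv, Complex.norm_real,
        Real.norm_of_nonneg (show 0 ≤ aNorm A x from Real.sqrt_nonneg _)]
      exact inv_mul_cancel₀ h0
    have h1 := norm_aInner_row_le_of_unit hA hP hQ hyn hxz
    rw [← hxy] at h1
    have h2 := norm_aInner_le_aNumRadius hyn (AdmitsAAdjoint.aNumRadius_lt_top hA ⟨P', hP⟩)
    have h3 := aNorm_apply_le_aOpNorm hyn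
      ((isAAdjoint_id_add_comp_add_comp hA hP hQ).aOpNorm_lt_top hA)
    simp only [add_apply, ContinuousLinearMap.comp_apply,
      ContinuousLinearMap.id_apply] at h3
    linarith

end

end SemiHilbert

theorem mainTheorem2 {H : Type*} [NormedAddCommGroup H] [InnerProductSpace ℂ H] [CompleteSpace H]
    (A : H →L[ℂ] H) (hA : A.IsPositive) (P Q R S : H →L[ℂ] H)
    (hP : AdmitsAAdjoint A P) (hQ : AdmitsAAdjoint A Q)
    (hR : AdmitsAAdjoint A R) (hS : AdmitsAAdjoint A S) :
    aNumRadius (diagOp A) (blockOp P Q R S) ≤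
        (1 / 2) * (aNumRadius A P + aNumRadius A S) +
        (1 / 4) *
          (aOpNorm A (ContinuousLinearMap.id ℂ H + P ∘L aSharp A P + Q ∘L aSharp A Q) +
            aOpNorm A (ContinuousLinearMap.id ℂ H + R ∘L aSharp A R + S ∘L aSharp A S)) ∧
      aNumRadius A P < ⊤ ∧ aNumRadius A S < ⊤ ∧
      aOpNorm A (ContinuousLinearMap.id ℂ H + P ∘L aSharp A P + Q ∘L aSharp A Q) < ⊤ ∧
      aOpNorm A (ContinuousLinearMap.id ℂ H + R ∘L aSharp A R + S ∘L aSharp A S) < ⊤ := by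
  have hP' := isAAdjoint_aSharp hA hP
  have hQ' := isAAdjoint_aSharp hA hQ
  have hR' := isAAdjoint_aSharp hA hR
  have hS' := isAAdjoint_aSharp hA hS
  have fP := hP.aNumRadius_lt_top hA
  have fS := hS.aNumRadius_lt_top hA
  have fPQ := (isAAdjoint_id_add_comp_add_comp hA hP' hQ').aOpNorm_lt_top hA
  have fRS := (isAAdjoint_id_add_comp_add_comp hA hR' hS').aOpNorm_lt_top hA
  refine ⟨iSup₂_le fun x hx => ?_, fP, fS, fPQ, fRS⟩
  obtain ⟨B, hB⟩ := exists_aInner_eq hA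
  have hx2 : aNorm A x.fst ^ 2 + aNorm A x.snd ^ 2 = 1 := by
    rw [aNorm, Real.sqrt_eq_one, aInner_diagOp, hB, hB, inner_self_eq_norm_sq_to_K,
      inner_self_eq_norm_sq_to_K] at hx
    rw [aNorm_eq hB, aNorm_eq hB]
    norm_cast at hx
  have h1 := norm_aInner_row_le hA hP' hQ' hx2
  -- In the second row the diagonal entry is `S`, so the two coordinates exchange roles.
  have h2 := norm_aInner_row_le hA hS' hR' (add_comm (aNorm A x.fst ^ 2) _ ▸ hx2)
  rw [add_right_comm, add_comm (S x.snd)] at h2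
  rw [aInner_diagOp, blockOp_apply]
  refine ENNReal.ofReal_le_of_le_toReal ((norm_add_le _ _).trans ((add_le_add h1 h2).trans ?_))
  rw [ENNReal.toReal_add (by finiteness) (by finiteness), ENNReal.toReal_mul, ENNReal.toReal_mul,
    ENNReal.toReal_add fP.ne fS.ne, ENNReal.toReal_add fPQ.ne fRS.ne]
  apply le_of_eq
  norm_num
  ring
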